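/- Logarithms are to base $2$, $\|X\|_1=\operatorname{Tr}|X|$, $S(\sigma)=-\operatorname{Tr}(\sigma\log\sigma)$, $\eta(x)=-x\log x$ with $\eta(0)=0$, and $\rho^\Gamma=(\mathrm{id}\otimes T)(\rho)$ is the partial transpose. Three parties hold quantum systems $A$, $B$ and $C=C_1C_2$. $\mathrm{CLODCC}(A:C_1C_2:B)$ is the class of operations generated, under finite and convergent infinite composition, by (i) a unitary on the system held by one party, and (ii) one party sending a tensor factor of its system to another party through the channel that completely dephases this factor in its computational basis (the factor then belongs to the receiver). Ancillas are never added and nothing is discarded, so the operations may change the individual dimensions of $A$, $B$, $C$ but not their product. Proposition. Let $\rho$ be a state on $\mathbb{C}^{m}\otimes\mathbb{C}^{k}$, of total dimension $d=mk$, with $$\Big\|\rho^\Gamma-\frac{\mathbb I}{d}\Big\|_1\le\frac1{\mathrm e}.$$ Let $\Lambda\in\mathrm{CLODCC}(A:C_1C_2:B)$ be applied to $\rho_{AC_1}\otimes\rho_{C_2B}$, and let $\hat\rho_{AB}=\operatorname{Tr}_C\Lambda(\rho_{AC_1}\otimes\rho_{C_2B})$, a state of the output systems $A$, $B$, of total dimension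 $|AB|_{\hat\rho}$. Then $$\Big|\log|AB|_{\hat\rho}-S(AB)_{\hat\rho}\Big|\le 2\Big\|\rho^\Gamma-\frac{\mathbb I}{d}\Big\|_1\log d+\eta\Big(2\Big\|\rho^\Gamma-\frac{\mathbb I}{d}\Big\|_1\Big).$$ -/

import Mathlib

open scoped Kronecker Topology ComplexOrder

namespace Repeater

noncomputable section

/-- A density operator: positive semidefinite with unit trace. -/
structure IsState {ι : Type*} [Fintype ι] (ρ : Matrix ι ι ℂ) : Prop where
  posSemidef : ρ.PosSemidef
  trace_eq_one : ρ.trace = 1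

/-- The trace norm `Tr |X|` of a Hermitian matrix. -/
def traceNorm {ι : Type*} [Fintype ι] [DecidableEq ι] (X : Matrix ι ι ℂ) : ℝ :=
  (cfc (fun x : ℝ => |x|) X).trace.re

/-- The von Neumann entropy `-Tr (ρ log₂ ρ)` (with `0 log₂ 0 = 0`). -/
def entropy {ι : Type*} [Fintype ι] [DecidableEq ι] (ρ : Matrix ι ι ℂ) : ℝ :=
  -(ρ * cfc (Real.logb 2) ρ).trace.re

/-- `η(x) = -x log₂ x`. -/
def eta (x : ℝ) : ℝ := -x * Real.logb 2 x

/-- Partial transposition `id ⊗ T` of a bipartite matrix (on the second factor). -/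
def partialTranspose {ι κ : Type*} (ρ : Matrix (ι × κ) (ι × κ) ℂ) :
    Matrix (ι × κ) (ι × κ) ℂ :=
  Matrix.of fun x y => ρ (x.1, y.2) (y.1, x.2)

/-- The maximally mixed state on `ι`. -/
def maxMixed (ι : Type*) [Fintype ι] [DecidableEq ι] : Matrix ι ι ℂ :=
  ((Fintype.card ι : ℂ)⁻¹) • (1 : Matrix ι ι ℂ)

/-- The three parties. -/
inductive Party
  | A
  | B
  | C

/-- The dimensions of the systems held at a given moment by the parties `A`, `B`, `C`. -/
structure Labs where
  a : ℕ
  b : ℕ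
  c : ℕ

/-- The computational basis of the joint system `A ⊗ B ⊗ C`. -/
abbrev Labs.Basis (n : Labs) : Type := Fin n.a × Fin n.b × Fin n.c

/-- Operators on the joint system. -/
abbrev Labs.Op (n : Labs) : Type := Matrix n.Basis n.Basis ℂ

/-- The situation in which party `p` holds an additional `k`-dimensional tensor factor. -/
def Labs.extend (n : Labs) (k : ℕ) : Party → Labs
  | .A => ⟨n.a * k, n.b, n.c⟩
  | .B => ⟨n.a, n.b * k, n.c⟩
  | .C => ⟨n.a, n.b, n.c * k⟩

/-- Singling out the additional `k`-dimensional factor held by party `p`. -/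
def Labs.split (n : Labs) (k : ℕ) : (p : Party) → (n.extend k p).Basis ≃ n.Basis × Fin k
  | .A =>
    { toFun := fun x =>
        (((finProdFinEquiv.symm x.1).1, x.2.1, x.2.2), (finProdFinEquiv.symm x.1).2)
      invFun := fun y => (finProdFinEquiv (y.1.1, y.2), y.1.2.1, y.1.2.2)
      left_inv := fun x => Prod.ext (finProdFinEquiv.apply_symm_apply x.1) rfl
      right_inv := fun y => by
        simp only [Equiv.symm_apply_apply] }
  | .B =>
    { toFun := fun x =>
        ((x.1, (finProdFinEquiv.symm x.2.1).1, x.2.2), (finProdFinEquiv.symm x.2.1).2)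
      invFun := fun y => (y.1.1, finProdFinEquiv (y.1.2.1, y.2), y.1.2.2)
      left_inv := fun x =>
        Prod.ext rfl (Prod.ext (finProdFinEquiv.apply_symm_apply x.2.1) rfl)
      right_inv := fun y => by
        simp only [Equiv.symm_apply_apply] }
  | .C =>
    { toFun := fun x =>
        ((x.1, x.2.1, (finProdFinEquiv.symm x.2.2).1), (finProdFinEquiv.symm x.2.2).2)
      invFun := fun y => (y.1.1, y.1.2.1, finProdFinEquiv (y.1.2.2, y.2))
      left_inv := fun x =>
        Prod.ext rfl (Prod.ext rfl (finProdFinEquiv.apply_symm_apply x.2.2))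
      right_inv := fun y => by
        simp only [Equiv.symm_apply_apply] }

/-- Conjugation `X ↦ V X V†`. -/
def conjBy {ι : Type*} [Fintype ι] (V : Matrix ι ι ℂ) : Matrix ι ι ℂ →ₗ[ℂ] Matrix ι ι ℂ where
  toFun X := V * X * V.conjTranspose
  map_add' X Y := by rw [mul_add, add_mul]
  map_smul' r X := by simp

/-- Party `p` sends a `k`-dimensional tensor factor of its system to party `q` through the
dephasing channel: in the computational basis of that factor all off-diagonal blocks are erased,
and the factor becomes part of the system of `q`. -/
def Labs.send (n : Labs) (k : ℕ) (p q : Party) :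
    (n.extend k p).Op →ₗ[ℂ] (n.extend k q).Op where
  toFun X := Matrix.of fun x y =>
    if (n.split k q x).2 = (n.split k q y).2 then
      X ((n.split k p).symm (n.split k q x)) ((n.split k p).symm (n.split k q y))
    else 0
  map_add' X Y := by
    ext x y
    simp only [Matrix.of_apply, Matrix.add_apply]
    split_ifs <;> simp
  map_smul' r X := by
    ext x y
    simp only [Matrix.of_apply, Matrix.smul_apply, RingHom.id_apply]
    split_ifs <;> simp

/-- The composition `Φ (N-1) ∘ ⋯ ∘ Φ 0` of the first `N` maps of a sequence. -/
def firstMaps {n : Labs} (Φ : ℕ → (n.Op →ₗ[ℂ] n.Op)) : ℕ → (n.Op →ₗ[ℂ] n.Op)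
  | 0 => LinearMap.id
  | N + 1 => Φ N ∘ₗ firstMaps Φ N

/-- The class of closed local operations and dephasing communication between the three parties:
the operations generated by local unitaries and by sending subsystems through dephasing channels,
under finite composition and (convergent) infinite composition. -/
inductive CLODCC : (n n' : Labs) → (n.Op →ₗ[ℂ] n'.Op) → Prop
  | unitaryA (n : Labs) (U : Matrix (Fin n.a) (Fin n.a) ℂ)
      (hU : U ∈ Matrix.unitaryGroup (Fin n.a) ℂ) :
      CLODCC n n (conjBy (U ⊗ₖ (1 : Matrix (Fin n.b × Fin n.c) (Fin n.b × Fin n.c) ℂ)))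
  | unitaryB (n : Labs) (U : Matrix (Fin n.b) (Fin n.b) ℂ)
      (hU : U ∈ Matrix.unitaryGroup (Fin n.b) ℂ) :
      CLODCC n n (conjBy ((1 : Matrix (Fin n.a) (Fin n.a) ℂ) ⊗ₖ
        (U ⊗ₖ (1 : Matrix (Fin n.c) (Fin n.c) ℂ))))
  | unitaryC (n : Labs) (U : Matrix (Fin n.c) (Fin n.c) ℂ)
      (hU : U ∈ Matrix.unitaryGroup (Fin n.c) ℂ) :
      CLODCC n n (conjBy ((1 : Matrix (Fin n.a) (Fin n.a) ℂ) ⊗ₖ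
        ((1 : Matrix (Fin n.b) (Fin n.b) ℂ) ⊗ₖ U)))
  | send (n : Labs) (k : ℕ) (p q : Party) (hpq : p ≠ q) :
      CLODCC (n.extend k p) (n.extend k q) (n.send k p q)
  | comp {n₁ n₂ n₃ : Labs} {Φ : n₁.Op →ₗ[ℂ] n₂.Op} {Ψ : n₂.Op →ₗ[ℂ] n₃.Op}
      (hΦ : CLODCC n₁ n₂ Φ) (hΨ : CLODCC n₂ n₃ Ψ) : CLODCC n₁ n₃ (Ψ ∘ₗ Φ)
  | infinite {n : Labs} (Φ : ℕ → (n.Op →ₗ[ℂ] n.Op)) (hΦ : ∀ N, CLODCC n n (Φ N))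
      (Λ : n.Op →ₗ[ℂ] n.Op)
      (hΛ : ∀ X, Filter.Tendsto (fun N => firstMaps Φ N X) Filter.atTop (𝓝 (Λ X))) :
      CLODCC n n Λ

/-- The initial dimensions: `A`, `C₂` carry the first factor and `C₁`, `B` the second factor of a
state on `ℂ^m ⊗ ℂ^k`, and `C = C₁ ⊗ C₂`. -/
abbrev initialLabs (m k : ℕ) : Labs := ⟨m, k, k * m⟩

/-- The input `ρ_{AC₁} ⊗ ρ_{C₂B}`, with tensor factors ordered as `A`, `B`, `C₁C₂`. -/
def twoCopies {m k : ℕ} (ρ : Matrix (Fin m × Fin k) (Fin m × Fin k) ℂ) :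
    (initialLabs m k).Op :=
  Matrix.of fun x y =>
    ρ (x.1, (finProdFinEquiv.symm x.2.2).1) (y.1, (finProdFinEquiv.symm y.2.2).1) *
      ρ ((finProdFinEquiv.symm x.2.2).2, x.2.1) ((finProdFinEquiv.symm y.2.2).2, y.2.1)

/-- The partial trace over the system of `C`. -/
def traceC {n : Labs} (X : n.Op) : Matrix (Fin n.a × Fin n.b) (Fin n.a × Fin n.b) ℂ :=
  Matrix.of fun x y => ∑ c : Fin n.c, X (x.1, x.2, c) (y.1, y.2, c)

end

end Repeater

/-! The estimate `S ≤ log |AB|` is standard; the content is the upper bound on `log |AB| - S`.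
Conjugating `Λ` with the transposition at `C` gives another operation of the class: unitaries of `A`
and `B` are untouched, a unitary of `C` becomes its complex conjugate, and a dephased message does
not notice being transposed (`CLODCC.conjTransposeC`). Since `Tr_C` is insensitive to that
transposition, the output is the image of `ρ^Γ ⊗ (ρ^Γ)ᵀ` under a positive, trace-preserving, unital
map followed by `Tr_C` (`traceC_map_twoCopies`).

Let `x i` be the eigenvalues of `ρ^Γ` and `u i = d * x i`. The output spectrum, rescaled by `|AB|`,
is then obtained by averaging the products `u i * u j`. Jensen's inequality bounds `log |AB| - S` by
the mean of a convex majorant of `t log t` over these products (`IsState.log_card_sub_entropy_le`).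
The majorant `t⁺ log⁺ t` is needed because the products may be negative.

Finally, the `u i` have mean one, satisfy `|u i| ≤ d` because `Γ` preserves the Hilbert–Schmidt
norm, and are `d * ε` away from `1` in `ℓ¹`. This bounds the mean (`sum_mulPosLog_mul_le`), and `ε ≤
1/e` turns the result into the stated form (`numeric_entropy_bound`). -/

namespace Repeater

section Scalar

open Real

/-! ### Scalar inequalities -/

/-- The convex majorant `u ↦ u⁺ log⁺ u` of `u ↦ u log u`. -/
noncomputable def mulPosLog (u : ℝ) : ℝ := max u 0 * posLog u

lemma mulPosLog_eq_max (u : ℝ) : mulPosLog u = max u 1 * log (max u 1) := by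
  unfold mulPosLog
  rcases le_total u 1 with h | h
  · rw [max_eq_right h, log_one, mul_zero]
    rcases le_total u 0 with h0 | h0
    · rw [max_eq_right h0, zero_mul]
    · rw [(posLog_eq_zero_iff u).2 (by rwa [abs_of_nonneg h0]), mul_zero]
  · rw [max_eq_left h, max_eq_left (by linarith),
      posLog_eq_log (by rwa [abs_of_nonneg (by linarith)])]

lemma mulPosLog_nonneg (u : ℝ) : 0 ≤ mulPosLog u :=
  mul_nonneg (le_max_right _ _) posLog_nonneg

lemma mul_log_le_mulPosLog {u : ℝ} (hu : 0 ≤ u) : u * log u ≤ mulPosLog u := by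
  unfold mulPosLog
  rw [max_eq_left hu]
  exact mul_le_mul_of_nonneg_left (le_max_right _ _) hu

/-- The function `t log t` is convex and increasing on `[1, ∞)`, and `max u 1` is convex with values
there. Convexity on the whole line lets Jensen's inequality accept negative arguments. -/
lemma convexOn_mulPosLog : ConvexOn ℝ Set.univ mulPosLog := by
  have hmax : ConvexOn ℝ Set.univ (fun u : ℝ => max u 1) :=
    (convexOn_id convex_univ).sup (convexOn_const _ convex_univ)
  have himg : (fun u : ℝ => max u 1) '' Set.univ = Set.Ici 1 := by
    ext x
    simp only [Set.image_univ, Set.mem_range, Set.mem_Ici]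
    exact ⟨fun ⟨y, hy⟩ => hy ▸ le_max_right _ _, fun h => ⟨x, max_eq_left h⟩⟩
  have h := ConvexOn.comp (g := fun x : ℝ => x * log x) (f := fun u : ℝ => max u 1)
    (s := Set.univ) (𝕜 := ℝ)
    (by
      rw [himg]
      exact convexOn_mul_log.subset (fun x (hx : (1 : ℝ) ≤ x) => (zero_le_one.trans hx : (0 : ℝ) ≤ x)) (convex_Ici 1))
    hmax
    (by
      rw [himg]
      intro x hx y hy hxy
      have hx' : (1 : ℝ) ≤ x := hx
      exact mul_le_mul hxy (log_le_log (by linarith) hxy) (log_nonneg hx') (by linarith))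
  convert h using 1
  ext u
  exact mulPosLog_eq_max u

/-- A product is positive only for factors of equal sign, and `log⁺` is subadditive on products.
`posLog` sees only absolute values, so pairs of negative factors are covered. -/
lemma mulPosLog_mul_le (u v : ℝ) :
    mulPosLog (u * v) ≤
      (max u 0 * max v 0 + max (-u) 0 * max (-v) 0) * (posLog u + posLog v) := by
  have h : max (u * v) 0 ≤ max u 0 * max v 0 + max (-u) 0 * max (-v) 0 := by
    rcases le_total u 0 with hu | hu <;> rcases le_total v 0 with hv | hv <;>
      simp [hu, hv, mul_nonneg_of_nonpos_of_nonpos, mul_nonneg, mul_nonpos_of_nonneg_of_nonpos,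
        mul_nonpos_of_nonpos_of_nonneg]
  exact mul_le_mul h posLog_mul posLog_nonneg (by positivity)

/-- The chord of `u log u` over `[1, d]`. -/
lemma mulPosLog_le_chord {d : ℕ} {u : ℝ} (hu : u ≤ d) :
    mulPosLog u ≤ max (u - 1) 0 * (log d + log 2) := by
  rw [mulPosLog_eq_max]
  rcases le_or_gt u 1 with h | h
  · rw [max_eq_right h, max_eq_right (by linarith)]
    simp
  rw [max_eq_left h.le, max_eq_left (by linarith)]
  have hd1 : (1 : ℝ) < d := h.trans_le hu
  have hd2 : 2 ≤ d := by
    have : 1 < d := by exact_mod_cast hd1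
    omega
  -- The chord has slope `d log d / (d - 1) = log d + log d / (d - 1)`; this inequality bounds the
  -- last term by `log 2`.
  have hpow : (d : ℝ) ≤ 2 ^ (d - 1) := by
    have : d - 1 < 2 ^ (d - 1) := Nat.lt_two_pow_self
    have h2 : d ≤ 2 ^ (d - 1) := by omega
    exact_mod_cast h2
  have hlog : log d ≤ (d - 1) * log 2 := by
    have := log_le_log (by linarith) hpow
    rwa [log_pow, Nat.cast_sub (by omega), Nat.cast_one] at this
  have hne : (d : ℝ) - 1 ≠ 0 := by linarith
  have ha : 0 ≤ ((d : ℝ) - u) / (d - 1) := div_nonneg (by linarith) (by linarith)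
  have hb : 0 ≤ (u - 1) / ((d : ℝ) - 1) := div_nonneg (by linarith) (by linarith)
  have hab : ((d : ℝ) - u) / (d - 1) + (u - 1) / (d - 1) = 1 := by field_simp; ring
  have hconv := convexOn_mul_log.2 (Set.mem_Ici.2 zero_le_one) (Set.mem_Ici.2 (Nat.cast_nonneg d))
    ha hb hab
  have e1 : ((d : ℝ) - u) / (d - 1) * 1 + (u - 1) / (d - 1) * d = u := by
    field_simp; ring
  simp only [smul_eq_mul, log_one, mul_zero, zero_add, e1] at hconv
  refine hconv.trans ?_
  rw [div_mul_eq_mul_div, div_le_iff₀ (by linarith), mul_assoc]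
  refine mul_le_mul_of_nonneg_left ?_ (by linarith)
  linarith

/-- Bound on the average of `mulPosLog` over products of a family with mean one. -/
lemma sum_mulPosLog_mul_le {ι : Type*} [Fintype ι] (d : ℕ) (u : ι → ℝ)
    (hcard : Fintype.card ι = d) (hsum : ∑ i, u i = d) (habs : ∀ i, |u i| ≤ d)
    {P : ℝ} (hP : ∑ i, |u i - 1| = 2 * P) :
    ∑ i, ∑ j, mulPosLog (u i * u j) ≤
      2 * ((d + P) * (P * (log d + log 2)) + P * (P * log d)) := by
  have hsub : ∑ i, (u i - 1) = 0 := by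
    rw [Finset.sum_sub_distrib, hsum]; simp [hcard]
  -- The deviations `u i - 1` sum to zero, so their positive and negative parts each carry half of
  -- the `ℓ¹` norm.
  have hPpos : ∑ i, max (u i - 1) 0 = P := by
    have : ∀ i, max (u i - 1) 0 = ((u i - 1) + |u i - 1|) / 2 := fun i => by
      rcases le_total (u i - 1) 0 with h | h
      · rw [max_eq_right h, abs_of_nonpos h]; ring
      · rw [max_eq_left h, abs_of_nonneg h]; ring
    simp_rw [this]
    rw [← Finset.sum_div, Finset.sum_add_distrib, hsub, hP]; ring
  have hPneg : ∑ i, max (1 - u i) 0 = P := by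
    have : ∀ i, max (1 - u i) 0 = (-(u i - 1) + |u i - 1|) / 2 := fun i => by
      rcases le_total (u i - 1) 0 with h | h
      · rw [max_eq_left (by linarith), abs_of_nonpos h]; ring
      · rw [max_eq_right (by linarith), abs_of_nonneg h]; ring
    simp_rw [this]
    rw [← Finset.sum_div, Finset.sum_add_distrib, Finset.sum_neg_distrib, hsub, hP]; ring
  have hP0 : 0 ≤ P := by
    rw [← hPpos]; exact Finset.sum_nonneg fun i _ => le_max_right _ _
  have hN : ∑ i, max (-u i) 0 ≤ P := by
    rw [← hPneg]
    exact Finset.sum_le_sum fun i _ => max_le_max (by linarith) le_rfl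
  have hN0 : 0 ≤ ∑ i, max (-u i) 0 := Finset.sum_nonneg fun i _ => le_max_right _ _
  have hpos : ∑ i, max (u i) 0 = d + ∑ i, max (-u i) 0 := by
    rw [← hsum, ← Finset.sum_add_distrib]
    refine Finset.sum_congr rfl fun i _ => ?_
    rcases le_total (u i) 0 with h | h
    · rw [max_eq_right h, max_eq_left (by linarith)]; ring
    · rw [max_eq_left h, max_eq_right (by linarith)]; ring
  have hb : ∑ i, max (u i) 0 * posLog (u i) ≤ P * (log d + log 2) := by
    rw [← hPpos, Finset.sum_mul]
    exact Finset.sum_le_sum fun i _ => mulPosLog_le_chord ((le_abs_self _).trans (habs i))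
  have hb0 : 0 ≤ ∑ i, max (u i) 0 * posLog (u i) :=
    Finset.sum_nonneg fun i _ => mulPosLog_nonneg _
  have hL : 0 ≤ log d := log_natCast_nonneg d
  have hc : ∑ i, max (-u i) 0 * posLog (u i) ≤ P * log d := by
    refine le_trans ?_ (mul_le_mul_of_nonneg_right hN hL)
    rw [Finset.sum_mul]
    refine Finset.sum_le_sum fun i _ => mul_le_mul_of_nonneg_left ?_ (le_max_right _ _)
    rw [← posLog_abs, ← log_of_nat_eq_posLog]
    exact posLog_le_posLog (abs_nonneg _) (habs i)
  have hc0 : 0 ≤ ∑ i, max (-u i) 0 * posLog (u i) :=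
    Finset.sum_nonneg fun i _ => mul_nonneg (le_max_right _ _) posLog_nonneg
  have key : ∑ i, ∑ j, mulPosLog (u i * u j) ≤
      2 * ((∑ i, max (u i) 0) * (∑ i, max (u i) 0 * posLog (u i)) +
        (∑ i, max (-u i) 0) * (∑ i, max (-u i) 0 * posLog (u i))) := by
    refine (Finset.sum_le_sum fun i _ => Finset.sum_le_sum fun j _ =>
      mulPosLog_mul_le (u i) (u j)).trans (le_of_eq ?_)
    have e : ∀ i j, (max (u i) 0 * max (u j) 0 + max (-u i) 0 * max (-u j) 0) *
        (posLog (u i) + posLog (u j)) =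
        (max (u i) 0 * posLog (u i)) * max (u j) 0 + max (u i) 0 * (max (u j) 0 * posLog (u j))
        + ((max (-u i) 0 * posLog (u i)) * max (-u j) 0
          + max (-u i) 0 * (max (-u j) 0 * posLog (u j))) := fun i j => by ring
    simp_rw [e, Finset.sum_add_distrib, ← Finset.sum_mul_sum]
    ring
  refine key.trans ?_
  have hL2 : 0 ≤ log 2 := log_nonneg one_le_two
  gcongr
  rw [hpos]
  gcongr

/-- The numerical inequality behind the entropy bound (in nats). -/
lemma numeric_entropy_bound {d : ℕ} (hd : 2 ≤ d) {ε : ℝ} (h0 : 0 ≤ ε) (he : ε ≤ 1 / exp 1) :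
    (ε + ε ^ 2) * log d + (ε + ε ^ 2 / 2) * log 2 ≤
      2 * ε * log d + -(2 * ε) * log (2 * ε) := by
  rcases h0.eq_or_lt with rfl | hpos
  · simp
  have hL : log 2 ≤ log d := log_le_log two_pos (by exact_mod_cast hd)
  have hlogε : log ε ≤ -1 := by
    have := log_le_log hpos he
    rwa [one_div, log_inv, log_exp] at this
  have hε : ε ≤ 0.4 := by
    have h1 : (2.5 : ℝ) ≤ exp 1 := by have := exp_one_gt_d9; linarith
    calc ε ≤ 1 / exp 1 := he
      _ ≤ 1 / 2.5 := one_div_le_one_div_of_le (by norm_num) h1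
      _ = 0.4 := by norm_num
  have h2 : log 2 < 0.6931471808 := log_two_lt_d9
  have h2' : 0 < log 2 := log_pos one_lt_two
  rw [log_mul two_ne_zero hpos.ne']
  have a1 : (1 - ε) * log 2 ≤ (1 - ε) * log d :=
    mul_le_mul_of_nonneg_left hL (by linarith)
  have a2 : ε * log 2 ≤ 0.4 * log 2 := mul_le_mul_of_nonneg_right hε h2'.le
  -- This is the difference of the two sides. With `log d ≥ log 2`, `log ε ≤ -1` and `ε ≤ 0.4` the
  -- bracket is at least `2 - 2.6 log 2 > 0`.
  have : 0 ≤ ε * ((1 - ε) * log d - 2 * (log 2 + log ε) - (1 + ε / 2) * log 2) :=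
    mul_nonneg h0 (by nlinarith)
  nlinarith

end Scalar

/-! ### Spectral decompositions -/

lemma exists_spectral_decomposition {ι : Type*} [Fintype ι] [DecidableEq ι] {A : Matrix ι ι ℂ}
    (hA : A.IsHermitian) :
    ∃ (x : ι → ℝ) (Q : ι → Matrix ι ι ℂ), (∀ i, (Q i).PosSemidef) ∧
      (∀ i j, (Q i * Q j).trace = if i = j then 1 else 0) ∧ (∀ i, (Q i).trace = 1) ∧
      ∑ i, Q i = 1 ∧ ∀ f : ℝ → ℝ, cfc f A = ∑ i, (f (x i) : ℂ) • Q i := by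
  set U : Matrix ι ι ℂ := (hA.eigenvectorUnitary : Matrix ι ι ℂ) with hU
  have hUU : star U * U = 1 := Unitary.coe_star_mul_self _
  have hUU' : U * star U = 1 := Unitary.coe_mul_star_self _
  have hE : ∀ i, (Matrix.diagonal (Pi.single i 1) : Matrix ι ι ℂ).trace = 1 := fun i => by
    simp [Matrix.trace_diagonal]
  refine ⟨hA.eigenvalues, fun i => U * Matrix.diagonal (Pi.single i 1) * star U,
    fun i => ?_, fun i j => ?_, fun i => ?_, ?_, fun f => ?_⟩
  · refine Matrix.PosSemidef.mul_mul_conjTranspose_same (.diagonal ?_) U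
    exact Pi.single_nonneg.2 zero_le_one
  · have : U * Matrix.diagonal (Pi.single i 1) * star U *
        (U * Matrix.diagonal (Pi.single j 1) * star U) =
        U * (Matrix.diagonal (Pi.single i 1) * Matrix.diagonal (Pi.single j 1)) * star U := by
      simp only [Matrix.mul_assoc]
      rw [← Matrix.mul_assoc (star U) U, hUU, Matrix.one_mul]
    rw [this, Matrix.trace_mul_comm, ← Matrix.mul_assoc, hUU, Matrix.one_mul,
      Matrix.diagonal_mul_diagonal, Matrix.trace_diagonal]
    simp only [Pi.single_apply, mul_ite, mul_one, mul_zero, ← ite_and]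
    split_ifs with h
    · subst h; simp
    · refine Finset.sum_eq_zero fun l _ => if_neg fun h' => h (h'.2.symm.trans h'.1)
  · rw [Matrix.trace_mul_comm, ← Matrix.mul_assoc, hUU, Matrix.one_mul, hE]
  · rw [← Finset.sum_mul, ← Finset.mul_sum]
    have : ∑ i, (Matrix.diagonal (Pi.single i 1) : Matrix ι ι ℂ) = 1 := by
      ext a b
      simp [Matrix.sum_apply, Matrix.diagonal_apply, Matrix.one_apply, Pi.single_apply]
    rw [this, Matrix.mul_one, hUU']
  · rw [hA.cfc_eq, Matrix.IsHermitian.cfc, Unitary.conjStarAlgAut_apply]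
    have : (Matrix.diagonal (RCLike.ofReal ∘ f ∘ hA.eigenvalues) : Matrix ι ι ℂ) =
        ∑ i, (f (hA.eigenvalues i) : ℂ) • Matrix.diagonal (Pi.single i 1) := by
      ext a b
      simp [Matrix.sum_apply, Matrix.diagonal_apply, Pi.single_apply]
    rw [this, Finset.mul_sum, Finset.sum_mul]
    simp [hU]

lemma cfc_id_eq {ι : Type*} [Fintype ι] [DecidableEq ι] {A : Matrix ι ι ℂ}
    (hA : A.IsHermitian) : cfc (fun x : ℝ => x) A = A :=
  cfc_id' ℝ A hA.isSelfAdjoint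

open scoped MatrixOrder in
lemma trace_mul_nonneg {ι : Type*} [Fintype ι] [DecidableEq ι] {A B : Matrix ι ι ℂ}
    (hA : A.PosSemidef) (hB : B.PosSemidef) : 0 ≤ (A * B).trace := by
  obtain ⟨C, rfl⟩ := CStarAlgebra.nonneg_iff_eq_star_mul_self.1 hB.nonneg
  rw [← Matrix.mul_assoc, Matrix.trace_mul_comm, ← Matrix.mul_assoc]
  exact (hA.mul_mul_conjTranspose_same C).trace_nonneg

/-- A state has an eigenvalue distribution that computes its entropy. -/
lemma IsState.exists_spectrum {ι : Type*} [Fintype ι] [DecidableEq ι] {σ : Matrix ι ι ℂ}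
    (hσ : IsState σ) :
    ∃ (l : ι → ℝ) (Q : ι → Matrix ι ι ℂ), (∀ i, (Q i).PosSemidef) ∧ (∀ i, (Q i).trace = 1) ∧
      ∑ i, Q i = 1 ∧ σ = ∑ i, (l i : ℂ) • Q i ∧ (∀ i, (Q i * σ).trace = l i) ∧
      (∀ i, 0 ≤ l i) ∧ ∑ i, l i = 1 ∧
      entropy σ = -∑ i, l i * Real.logb 2 (l i) := by
  have hH := hσ.posSemidef.isHermitian
  obtain ⟨l, Q, hQ, hQQ, hQ1, hsum, hf⟩ := exists_spectral_decomposition hH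
  have hσQ : σ = ∑ i, (l i : ℂ) • Q i := by rw [← hf fun x => x, cfc_id_eq hH]
  have hl : ∀ i, (Q i * σ).trace = l i := fun i => by
    rw [hσQ, Finset.mul_sum, Matrix.trace_sum]
    simp [hQQ]
  refine ⟨l, Q, hQ, hQ1, hsum, hσQ, hl, fun i => ?_, ?_, ?_⟩
  · have := trace_mul_nonneg (hQ i) hσ.posSemidef
    rw [hl] at this
    exact_mod_cast this
  · have := hσ.trace_eq_one
    rw [hσQ, Matrix.trace_sum] at this
    simp only [Matrix.trace_smul, hQ1, smul_eq_mul, mul_one] at this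
    exact_mod_cast this
  · unfold entropy
    rw [hf, Finset.mul_sum, Matrix.trace_sum, Complex.re_sum, ← Finset.sum_neg_distrib]
    rw [← Finset.sum_neg_distrib]
    refine Finset.sum_congr rfl fun i _ => ?_
    rw [Matrix.mul_smul, Matrix.trace_smul, Matrix.trace_mul_comm, hl, smul_eq_mul,
      ← Complex.ofReal_mul, Complex.ofReal_re, mul_comm]

/-- `log D - S(σ)` as an average of `u log u` over the rescaled spectrum. -/
lemma log_card_sub_entropy {ι : Type*} [Fintype ι] {l : ι → ℝ}
    (hl : ∀ i, 0 ≤ l i) (h1 : ∑ i, l i = 1) :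
    (Real.logb 2 (Fintype.card ι) - -∑ i, l i * Real.logb 2 (l i)) * Real.log 2 =
      (Fintype.card ι : ℝ)⁻¹ *
        ∑ i, (Fintype.card ι * l i) * Real.log (Fintype.card ι * l i) := by
  have hne : Nonempty ι := by
    by_contra h
    rw [not_nonempty_iff] at h
    simp at h1
  have hD : (Fintype.card ι : ℝ) ≠ 0 := by exact_mod_cast Fintype.card_ne_zero
  have e : ∀ i, (Fintype.card ι * l i) * Real.log (Fintype.card ι * l i) =
      Fintype.card ι * (l i * Real.log (Fintype.card ι) + l i * Real.log (l i)) := fun i => by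
    rcases (hl i).eq_or_lt with h | h
    · simp [← h]
    · rw [Real.log_mul hD h.ne']; ring
  have h2 : Real.log 2 ≠ 0 := (Real.log_pos one_lt_two).ne'
  simp_rw [e, ← Finset.mul_sum, Finset.sum_add_distrib, ← Finset.sum_mul, h1, Real.logb,
    mul_div_assoc', ← Finset.sum_div]
  field_simp
  ring

/-- The bound `t log t ≥ t - 1` is summed over the rescaled spectrum, which has mean one. -/
lemma IsState.entropy_le_log_card {ι : Type*} [Fintype ι] [DecidableEq ι] {σ : Matrix ι ι ℂ}
    (hσ : IsState σ) : entropy σ ≤ Real.logb 2 (Fintype.card ι) := by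
  obtain ⟨l, Q, -, -, -, -, -, hl0, hl1, hS⟩ := hσ.exists_spectrum
  have h2 : 0 < Real.log 2 := Real.log_pos one_lt_two
  have key := log_card_sub_entropy hl0 hl1
  rw [← hS] at key
  have : ∑ i, ((Fintype.card ι : ℝ) * l i - 1) ≤
      ∑ i, (Fintype.card ι * l i) * Real.log (Fintype.card ι * l i) := by
    refine Finset.sum_le_sum fun i _ => ?_
    rcases (hl0 i).eq_or_lt with h | h
    · simp [← h]
    · have hc : 0 < Fintype.card ι := Fintype.card_pos_iff.2 ⟨i⟩
      have hpos : 0 < (Fintype.card ι : ℝ) * l i := by positivity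
      have := Real.one_sub_inv_le_log_of_pos hpos
      have := mul_le_mul_of_nonneg_left this hpos.le
      rwa [mul_sub, mul_one, mul_inv_cancel₀ hpos.ne'] at this
  rw [Finset.sum_sub_distrib, ← Finset.mul_sum, hl1] at this
  simp only [mul_one, Finset.sum_const, Finset.card_univ, nsmul_eq_mul, sub_self] at this
  have h3 : 0 ≤ (Real.logb 2 (Fintype.card ι) - entropy σ) * Real.log 2 := by
    rw [key]; positivity
  have := nonneg_of_mul_nonneg_left h3 h2
  linarith

/-- Entropy bound for a state that is the image of a (possibly non-positive) combination of
positive unit-trace operators resolving a multiple of the identity. -/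
lemma IsState.log_card_sub_entropy_le {ι J : Type*} [Fintype ι] [DecidableEq ι] [Fintype J]
    {σ : Matrix ι ι ℂ} (hσ : IsState σ) {z : J → ℝ} {R : J → Matrix ι ι ℂ}
    (hR : ∀ j, (R j).PosSemidef) (hR1 : ∀ j, (R j).trace = 1) {c : ℕ}
    (hRsum : ∑ j, R j = (c : ℂ) • 1) (hσR : σ = ∑ j, (z j : ℂ) • R j)
    (hcard : Fintype.card J = Fintype.card ι * c) (hc : 0 < c) :
    (Real.logb 2 (Fintype.card ι) - entropy σ) * Real.log 2 ≤
      (Fintype.card J : ℝ)⁻¹ * ∑ j, mulPosLog (Fintype.card J * z j) := by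
  obtain ⟨l, Q, hQ, hQ1, hQsum, -, hQl, hl0, hl1, hS⟩ := hσ.exists_spectrum
  rw [hS, log_card_sub_entropy hl0 hl1]
  -- The transition matrix from the coefficients `z` to the eigenvalues `l`: nonnegative, with sum
  -- `c` over `j` and sum `1` over `i`. Hence `p i j / c` are Jensen weights for each `i`.
  set p : ι → J → ℝ := fun i j => ((Q i * R j).trace).re with hp
  have hp0 : ∀ i j, 0 ≤ p i j := fun i j =>
    (Complex.le_def.1 (trace_mul_nonneg (hQ i) (hR j))).1
  have hpj : ∀ j, ∑ i, p i j = 1 := fun j => by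
    simp only [hp]
    rw [← Complex.re_sum, ← Matrix.trace_sum, ← Finset.sum_mul, hQsum, Matrix.one_mul, hR1]
    simp
  have hpi : ∀ i, ∑ j, p i j = c := fun i => by
    simp only [hp]
    rw [← Complex.re_sum, ← Matrix.trace_sum, ← Finset.mul_sum, hRsum, Matrix.mul_smul,
      Matrix.mul_one, Matrix.trace_smul, hQ1]
    simp
  have hl : ∀ i, l i = ∑ j, p i j * z j := fun i => by
    have h := congrArg Complex.re (hQl i)
    rw [Complex.ofReal_re, hσR, Finset.mul_sum, Matrix.trace_sum, Complex.re_sum] at h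
    rw [← h]
    refine Finset.sum_congr rfl fun j _ => ?_
    rw [Matrix.mul_smul, Matrix.trace_smul, smul_eq_mul, Complex.re_ofReal_mul, mul_comm]
  have hc' : (0 : ℝ) < c := by exact_mod_cast hc
  have hjensen : ∀ i, mulPosLog (Fintype.card ι * l i) ≤
      ∑ j, p i j / c * mulPosLog (Fintype.card J * z j) := fun i => by
    have h := convexOn_mulPosLog.map_sum_le (t := Finset.univ) (w := fun j => p i j / c)
      (p := fun j => Fintype.card J * z j) (fun j _ => div_nonneg (hp0 i j) hc'.le)
      (by rw [← Finset.sum_div, hpi, div_self hc'.ne']) (fun _ _ => Set.mem_univ _)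
    simp only [smul_eq_mul] at h
    refine le_of_eq_of_le (congrArg mulPosLog ?_) h
    rw [hl, Finset.mul_sum]
    refine Finset.sum_congr rfl fun j _ => ?_
    rw [hcard]
    push_cast
    field_simp
  calc (Fintype.card ι : ℝ)⁻¹ * ∑ i, (Fintype.card ι * l i) * Real.log (Fintype.card ι * l i)
      ≤ (Fintype.card ι : ℝ)⁻¹ * ∑ i, ∑ j, p i j / c * mulPosLog (Fintype.card J * z j) := by
        refine mul_le_mul_of_nonneg_left (Finset.sum_le_sum fun i _ => ?_) (by positivity)
        exact (mul_log_le_mulPosLog (mul_nonneg (Nat.cast_nonneg _) (hl0 i))).trans (hjensen i)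
    _ = (Fintype.card J : ℝ)⁻¹ * ∑ j, mulPosLog (Fintype.card J * z j) := by
        rw [Finset.sum_comm]
        simp_rw [← Finset.sum_mul, ← Finset.sum_div, hpj]
        rw [← Finset.mul_sum, ← mul_assoc, hcard]
        push_cast
        rw [mul_inv, one_div]

/-! ### Unital channels and partial transposition at `C` -/

/-- A positive, trace-preserving and unital linear map. -/
structure IsUnitalPositive {ι κ : Type*} [Fintype ι] [DecidableEq ι] [Fintype κ] [DecidableEq κ]
    (Φ : Matrix ι ι ℂ →ₗ[ℂ] Matrix κ κ ℂ) : Prop where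
  posSemidef_map : ∀ X, X.PosSemidef → (Φ X).PosSemidef
  trace_map : ∀ X, (Φ X).trace = X.trace
  map_one : Φ 1 = 1

lemma isUnitalPositive_conjBy {ι : Type*} [Fintype ι] [DecidableEq ι] {V : Matrix ι ι ℂ}
    (hV : V ∈ Matrix.unitaryGroup ι ℂ) : IsUnitalPositive (conjBy V) where
  posSemidef_map X hX := hX.mul_mul_conjTranspose_same V
  trace_map X := by
    have : V.conjTranspose * V = 1 := Matrix.mem_unitaryGroup_iff'.1 hV
    change (V * X * V.conjTranspose).trace = X.trace
    rw [Matrix.trace_mul_comm, ← Matrix.mul_assoc, this, Matrix.one_mul]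
  map_one := by
    have : V * V.conjTranspose = 1 := Matrix.mem_unitaryGroup_iff.1 hV
    change V * 1 * V.conjTranspose = 1
    rw [Matrix.mul_one, this]

/-- Dephasing is a Schur product with a positive semidefinite 0/1 mask, so Schur's product theorem
yields positivity. -/
lemma send_eq_hadamard (n : Labs) (k : ℕ) (p q : Party) (X : (n.extend k p).Op) :
    n.send k p q X =
      (X.submatrix ((n.split k q).trans (n.split k p).symm)
        ((n.split k q).trans (n.split k p).symm)).hadamard
      ((1 : Matrix (Fin k) (Fin k) ℂ).submatrix (fun x => (n.split k q x).2)
        (fun x => (n.split k q x).2)) := by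
  ext x y
  simp [Labs.send, Matrix.hadamard, Matrix.one_apply]

lemma isUnitalPositive_send (n : Labs) (k : ℕ) (p q : Party) :
    IsUnitalPositive (n.send k p q) where
  posSemidef_map X hX := by
    rw [send_eq_hadamard]
    exact (hX.submatrix _).hadamard (Matrix.PosSemidef.one.submatrix _)
  trace_map X := by
    rw [send_eq_hadamard]
    refine Eq.trans ?_
      (Equiv.sum_comp ((n.split k q).trans (n.split k p).symm) fun x => X x x)
    simp [Matrix.trace]
  map_one := by
    rw [send_eq_hadamard]
    ext x y
    by_cases h : x = y
    · subst h; simp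
    · simp [Matrix.one_apply, h]

lemma IsUnitalPositive.comp {ι κ τ : Type*} [Fintype ι] [DecidableEq ι] [Fintype κ]
    [DecidableEq κ] [Fintype τ] [DecidableEq τ] {Φ : Matrix ι ι ℂ →ₗ[ℂ] Matrix κ κ ℂ}
    {Ψ : Matrix κ κ ℂ →ₗ[ℂ] Matrix τ τ ℂ} (hΨ : IsUnitalPositive Ψ) (hΦ : IsUnitalPositive Φ) :
    IsUnitalPositive (Ψ ∘ₗ Φ) where
  posSemidef_map X hX := hΨ.posSemidef_map _ (hΦ.posSemidef_map X hX)
  trace_map X := (hΨ.trace_map _).trans (hΦ.trace_map X)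
  map_one := by rw [LinearMap.comp_apply, hΦ.map_one, hΨ.map_one]

lemma isUnitalPositive_firstMaps {n : Labs} {Φ : ℕ → (n.Op →ₗ[ℂ] n.Op)}
    (hΦ : ∀ N, IsUnitalPositive (Φ N)) : ∀ N, IsUnitalPositive (firstMaps Φ N)
  | 0 => ⟨fun _ h => h, fun _ => rfl, rfl⟩
  | N + 1 => (hΦ N).comp (isUnitalPositive_firstMaps hΦ N)

lemma posSemidef_of_tendsto {ι : Type*} [Fintype ι] {X : ℕ → Matrix ι ι ℂ} {Y : Matrix ι ι ℂ}
    (hX : ∀ N, (X N).PosSemidef) (h : Filter.Tendsto X Filter.atTop (𝓝 Y)) : Y.PosSemidef := by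
  refine Matrix.PosSemidef.of_dotProduct_mulVec_nonneg ?_ fun v => ?_
  · have h1 : Filter.Tendsto (fun N => (X N).conjTranspose) Filter.atTop
        (𝓝 Y.conjTranspose) := (continuous_id.matrix_conjTranspose.tendsto Y).comp h
    exact tendsto_nhds_unique (h1.congr fun N => (hX N).isHermitian) h
  · have hc : Continuous fun M : Matrix ι ι ℂ => star v ⬝ᵥ M.mulVec v :=
      continuous_const.dotProduct (continuous_id.matrix_mulVec continuous_const)
    exact ge_of_tendsto' ((hc.tendsto Y).comp h) fun N => (hX N).dotProduct_mulVec_nonneg v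

lemma isUnitalPositive_of_tendsto {ι κ : Type*} [Fintype ι] [DecidableEq ι] [Fintype κ]
    [DecidableEq κ] {Φ : ℕ → (Matrix ι ι ℂ →ₗ[ℂ] Matrix κ κ ℂ)}
    {Λ : Matrix ι ι ℂ →ₗ[ℂ] Matrix κ κ ℂ} (hΦ : ∀ N, IsUnitalPositive (Φ N))
    (h : ∀ X, Filter.Tendsto (fun N => Φ N X) Filter.atTop (𝓝 (Λ X))) :
    IsUnitalPositive Λ where
  posSemidef_map X hX := posSemidef_of_tendsto (fun N => (hΦ N).posSemidef_map X hX) (h X)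
  trace_map X := by
    have h1 := ((continuous_id.matrix_trace).tendsto (Λ X)).comp (h X)
    refine tendsto_nhds_unique h1 (tendsto_const_nhds.congr fun N => ?_)
    exact ((hΦ N).trace_map X).symm
  map_one := tendsto_nhds_unique (h 1) (tendsto_const_nhds.congr fun N => (hΦ N).map_one.symm)

theorem CLODCC.isUnitalPositive {n n' : Labs} {Φ : n.Op →ₗ[ℂ] n'.Op} (h : CLODCC n n' Φ) :
    IsUnitalPositive Φ := by
  induction h with
  | unitaryA n U hU =>
    exact isUnitalPositive_conjBy (Matrix.kronecker_mem_unitary hU (one_mem _))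
  | unitaryB n U hU =>
    exact isUnitalPositive_conjBy (Matrix.kronecker_mem_unitary (one_mem _)
      (Matrix.kronecker_mem_unitary hU (one_mem _)))
  | unitaryC n U hU =>
    exact isUnitalPositive_conjBy (Matrix.kronecker_mem_unitary (one_mem _)
      (Matrix.kronecker_mem_unitary (one_mem _) hU))
  | send n k p q hpq => exact isUnitalPositive_send n k p q
  | comp _ _ ih₁ ih₂ => exact ih₂.comp ih₁
  | infinite Φ _ Λ hΛ ih => exact isUnitalPositive_of_tendsto (isUnitalPositive_firstMaps ih) hΛ

/-- The total dimension is preserved. -/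
theorem CLODCC.dim_eq {n n' : Labs} {Φ : n.Op →ₗ[ℂ] n'.Op} (h : CLODCC n n' Φ) :
    n'.a * n'.b * n'.c = n.a * n.b * n.c := by
  -- A unital trace-preserving map forces the two identity matrices to have equal trace.
  have h1 := h.isUnitalPositive.trace_map 1
  rw [h.isUnitalPositive.map_one, Matrix.trace_one, Matrix.trace_one] at h1
  have h2 : Fintype.card n'.Basis = Fintype.card n.Basis := by exact_mod_cast h1
  simpa [mul_assoc] using h2

/-- Partial transposition on the system of `C`. -/
noncomputable def transposeC (n : Labs) : n.Op →ₗ[ℂ] n.Op where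
  toFun X := Matrix.of fun x y => X (x.1, x.2.1, y.2.2) (y.1, y.2.1, x.2.2)
  map_add' _ _ := rfl
  map_smul' _ _ := rfl

@[simp]
lemma transposeC_apply {n : Labs} (X : n.Op) (x y : n.Basis) :
    transposeC n X x y = X (x.1, x.2.1, y.2.2) (y.1, y.2.1, x.2.2) := rfl

/-- The conjugate of a map by partial transposition at `C`. -/
noncomputable def conjTransposeC {n n' : Labs} (Φ : n.Op →ₗ[ℂ] n'.Op) : n.Op →ₗ[ℂ] n'.Op :=
  transposeC n' ∘ₗ Φ ∘ₗ transposeC n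

lemma ite_zero_congr {P Q : Prop} [Decidable P] [Decidable Q] {a b : ℂ} (h : P ↔ Q)
    (hab : Q → a = b) : (if P then a else 0) = if Q then b else 0 := by
  by_cases hQ : Q
  · rw [if_pos hQ, if_pos (h.2 hQ), hab hQ]
  · rw [if_neg hQ, if_neg (mt h.1 hQ)]

/-- After dephasing, the row and column labels of the sent factor agree. Transposing this factor
therefore does nothing, whichever side of the transposition it starts or ends on. -/
lemma conjTransposeC_send (n : Labs) (k : ℕ) (p q : Party) :
    conjTransposeC (n.send k p q) = n.send k p q := by
  refine LinearMap.ext fun X => ?_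
  ext x y
  rcases p <;> rcases q
  iterate 2
    · exact ite_zero_congr Iff.rfl fun _ => rfl
    · exact ite_zero_congr Iff.rfl fun _ => rfl
    · refine ite_zero_congr eq_comm fun h => ?_
      change (finProdFinEquiv.symm x.2.2).2 = (finProdFinEquiv.symm y.2.2).2 at h
      simp only [Labs.split, Equiv.coe_fn_mk, Equiv.coe_fn_symm_mk, h]
      rfl
  · refine ite_zero_congr Iff.rfl fun h => ?_
    change (finProdFinEquiv.symm x.1).2 = (finProdFinEquiv.symm y.1).2 at h
    change X (_, _, finProdFinEquiv (_, (finProdFinEquiv.symm y.1).2))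
        (_, _, finProdFinEquiv (_, (finProdFinEquiv.symm x.1).2)) =
      X (_, _, finProdFinEquiv (_, (finProdFinEquiv.symm x.1).2))
        (_, _, finProdFinEquiv (_, (finProdFinEquiv.symm y.1).2))
    rw [h]
    rfl
  · refine ite_zero_congr Iff.rfl fun h => ?_
    change (finProdFinEquiv.symm x.2.1).2 = (finProdFinEquiv.symm y.2.1).2 at h
    change X (_, _, finProdFinEquiv (_, (finProdFinEquiv.symm y.2.1).2))
        (_, _, finProdFinEquiv (_, (finProdFinEquiv.symm x.2.1).2)) =
      X (_, _, finProdFinEquiv (_, (finProdFinEquiv.symm x.2.1).2))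
        (_, _, finProdFinEquiv (_, (finProdFinEquiv.symm y.2.1).2))
    rw [h]
    rfl
  · refine ite_zero_congr eq_comm fun _ => ?_
    change X ((n.split k .C).symm (n.split k .C x)) ((n.split k .C).symm (n.split k .C y)) = _
    rfl

lemma conjTransposeC_unitaryA (n : Labs) (U : Matrix (Fin n.a) (Fin n.a) ℂ) :
    conjTransposeC (n := n) (n' := n)
      (conjBy (U ⊗ₖ (1 : Matrix (Fin n.b × Fin n.c) (Fin n.b × Fin n.c) ℂ))) =
      conjBy (U ⊗ₖ (1 : Matrix (Fin n.b × Fin n.c) (Fin n.b × Fin n.c) ℂ)) := by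
  refine LinearMap.ext fun X => ?_
  ext ⟨a, b, c⟩ ⟨a', b', c'⟩
  simp [conjTransposeC, conjBy, Matrix.mul_apply, Fintype.sum_prod_type, Matrix.one_apply,
    apply_ite (starRingEnd ℂ)]

lemma conjTransposeC_unitaryB (n : Labs) (U : Matrix (Fin n.b) (Fin n.b) ℂ) :
    conjTransposeC (n := n) (n' := n) (conjBy ((1 : Matrix (Fin n.a) (Fin n.a) ℂ) ⊗ₖ
        (U ⊗ₖ (1 : Matrix (Fin n.c) (Fin n.c) ℂ)))) =
      conjBy ((1 : Matrix (Fin n.a) (Fin n.a) ℂ) ⊗ₖ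
        (U ⊗ₖ (1 : Matrix (Fin n.c) (Fin n.c) ℂ))) := by
  refine LinearMap.ext fun X => ?_
  ext ⟨a, b, c⟩ ⟨a', b', c'⟩
  simp [conjTransposeC, conjBy, Matrix.mul_apply, Fintype.sum_prod_type, Matrix.one_apply,
    apply_ite (starRingEnd ℂ)]

/-- Transposition reverses products: `(U X U†)ᵀ = Ū Xᵀ Ū†`, applied to the `C` indices. -/
lemma conjTransposeC_unitaryC (n : Labs) (U : Matrix (Fin n.c) (Fin n.c) ℂ) :
    conjTransposeC (n := n) (n' := n) (conjBy ((1 : Matrix (Fin n.a) (Fin n.a) ℂ) ⊗ₖ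
        ((1 : Matrix (Fin n.b) (Fin n.b) ℂ) ⊗ₖ U))) =
      conjBy ((1 : Matrix (Fin n.a) (Fin n.a) ℂ) ⊗ₖ
        ((1 : Matrix (Fin n.b) (Fin n.b) ℂ) ⊗ₖ U.map star)) := by
  refine LinearMap.ext fun X => ?_
  ext ⟨a, b, c⟩ ⟨a', b', c'⟩
  simp [conjTransposeC, conjBy, Matrix.mul_apply, Fintype.sum_prod_type, Matrix.one_apply,
    apply_ite (starRingEnd ℂ), Finset.sum_mul]
  rw [Finset.sum_comm]
  refine Finset.sum_congr rfl fun i _ => Finset.sum_congr rfl fun j _ => ?_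
  ring

lemma conjTransposeC_firstMaps {n : Labs} (Φ : ℕ → (n.Op →ₗ[ℂ] n.Op)) (N : ℕ) :
    firstMaps (fun i => conjTransposeC (Φ i)) N = conjTransposeC (firstMaps Φ N) := by
  induction N with
  | zero => rfl
  | succ N ih => simp only [firstMaps, ih]; rfl

lemma map_star_mem_unitaryGroup {ι : Type*} [Fintype ι] [DecidableEq ι] {U : Matrix ι ι ℂ}
    (hU : U ∈ Matrix.unitaryGroup ι ℂ) : U.map star ∈ Matrix.unitaryGroup ι ℂ := by
  rw [Matrix.mem_unitaryGroup_iff] at hU ⊢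
  have h := congrArg (fun M : Matrix ι ι ℂ => M.map (starRingEnd ℂ)) hU
  simp only [Matrix.map_mul] at h
  ext i j
  have h' := congrFun (congrFun h i) j
  simpa [Matrix.mul_apply, Matrix.one_apply, apply_ite] using h'

/-- Generators go to generators, compositions to compositions because transposition is an
involution, and limits to limits by continuity. The conjugated map is therefore positive and unital,
although partial transposition alone is not positive in general. -/
theorem CLODCC.conjTransposeC {n n' : Labs} {Φ : n.Op →ₗ[ℂ] n'.Op} (h : CLODCC n n' Φ) :
    CLODCC n n' (conjTransposeC Φ) := by
  induction h with
  | unitaryA n U hU => rw [conjTransposeC_unitaryA]; exact .unitaryA n U hU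
  | unitaryB n U hU => rw [conjTransposeC_unitaryB]; exact .unitaryB n U hU
  | unitaryC n U hU =>
    rw [conjTransposeC_unitaryC]; exact .unitaryC n _ (map_star_mem_unitaryGroup hU)
  | send n k p q hpq => rw [conjTransposeC_send]; exact .send n k p q hpq
  | @comp _ _ _ Φ Ψ _ _ ih₁ ih₂ =>
    have h : Repeater.conjTransposeC (Ψ ∘ₗ Φ) =
        Repeater.conjTransposeC Ψ ∘ₗ Repeater.conjTransposeC Φ := rfl
    rw [h]
    exact .comp ih₁ ih₂
  | @infinite n Φ _ Λ hΛ ih =>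
    refine .infinite (fun i => Repeater.conjTransposeC (Φ i)) ih _ fun X => ?_
    have hc : Continuous (transposeC n) := LinearMap.continuous_of_finiteDimensional _
    simp only [conjTransposeC_firstMaps]
    exact (hc.tendsto _).comp (hΛ (transposeC n X))

/-! ### Partial trace over `C` -/

lemma traceC_eq_sum {n : Labs} (X : n.Op) :
    traceC X = ∑ c : Fin n.c, X.submatrix (fun x => (x.1, x.2, c)) (fun x => (x.1, x.2, c)) := by
  ext x y
  simp [traceC, Matrix.sum_apply]

lemma trace_traceC {n : Labs} (X : n.Op) : (traceC X).trace = X.trace := by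
  simp [traceC, Matrix.trace, Fintype.sum_prod_type]

lemma posSemidef_traceC {n : Labs} {X : n.Op} (hX : X.PosSemidef) : (traceC X).PosSemidef := by
  rw [traceC_eq_sum]
  exact Matrix.posSemidef_sum _ fun c _ => hX.submatrix _

lemma traceC_one (n : Labs) : traceC (1 : n.Op) = (n.c : ℂ) • 1 := by
  ext x y
  by_cases h : x = y
  · subst h; simp [traceC]
  · have : ∀ c : Fin n.c, ((x.1, x.2, c) : n.Basis) ≠ (y.1, y.2, c) := fun c hc =>
      h (Prod.ext (congrArg (fun t => t.1) hc) (congrArg (fun t => t.2.1) hc))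
    rw [Matrix.smul_apply, Matrix.one_apply_ne h]
    simp only [traceC, Matrix.of_apply, Matrix.one_apply_ne (this _), Finset.sum_const_zero,
      smul_zero]

lemma traceC_sum_smul {n : Labs} {J : Type*} [Fintype J] (z : J → ℂ) (R : J → n.Op) :
    traceC (∑ j, z j • R j) = ∑ j, z j • traceC (R j) := by
  ext x y
  simp only [traceC, Matrix.of_apply, Matrix.sum_apply, Matrix.smul_apply, Finset.smul_sum]
  rw [Finset.sum_comm]

/-! ### The two-copy input -/

/-- Sorting the tensor factors `A`, `B`, `C₁C₂` into `AC₁` and `C₂B`. -/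
def sortFactors (m k : ℕ) :
    (initialLabs m k).Basis ≃ (Fin m × Fin k) × (Fin m × Fin k) where
  toFun x := ((x.1, (finProdFinEquiv.symm x.2.2).1), ((finProdFinEquiv.symm x.2.2).2, x.2.1))
  invFun y := (y.1.1, y.2.2, finProdFinEquiv (y.1.2, y.2.1))
  left_inv x := Prod.ext rfl (Prod.ext rfl (finProdFinEquiv.apply_symm_apply x.2.2))
  right_inv y := by simp only [Equiv.symm_apply_apply]

/-- The operator `P_{AC₁} ⊗ (R_{C₂B})ᵀ`. -/
def pairTranspose {m k : ℕ} (P R : Matrix (Fin m × Fin k) (Fin m × Fin k) ℂ) :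
    (initialLabs m k).Op :=
  (P ⊗ₖ R.transpose).submatrix (sortFactors m k) (sortFactors m k)

lemma trace_submatrix_equiv_self {ι κ : Type*} [Fintype ι] [Fintype κ] (e : ι ≃ κ)
    (X : Matrix κ κ ℂ) : (X.submatrix e e).trace = X.trace :=
  Equiv.sum_comp e fun x => X x x

lemma isState_twoCopies {m k : ℕ} {ρ : Matrix (Fin m × Fin k) (Fin m × Fin k) ℂ}
    (hρ : IsState ρ) : IsState (twoCopies ρ) := by
  have h : twoCopies ρ = (ρ ⊗ₖ ρ).submatrix (sortFactors m k) (sortFactors m k) := rfl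
  rw [h]
  refine ⟨(hρ.posSemidef.kronecker hρ.posSemidef).submatrix _, ?_⟩
  rw [trace_submatrix_equiv_self, Matrix.trace_kronecker, hρ.trace_eq_one, one_mul]

lemma posSemidef_pairTranspose {m k : ℕ} {P R : Matrix (Fin m × Fin k) (Fin m × Fin k) ℂ}
    (hP : P.PosSemidef) (hR : R.PosSemidef) : (pairTranspose P R).PosSemidef :=
  (hP.kronecker hR.transpose).submatrix _

lemma trace_pairTranspose {m k : ℕ} (P R : Matrix (Fin m × Fin k) (Fin m × Fin k) ℂ) :
    (pairTranspose P R).trace = P.trace * R.trace := by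
  rw [pairTranspose, trace_submatrix_equiv_self, Matrix.trace_kronecker, Matrix.trace_transpose]

lemma pairTranspose_one {m k : ℕ} :
    pairTranspose (1 : Matrix (Fin m × Fin k) (Fin m × Fin k) ℂ) 1 = 1 := by
  rw [pairTranspose, Matrix.transpose_one, Matrix.one_kronecker_one, Matrix.submatrix_one_equiv]

lemma pairTranspose_sum {m k : ℕ} {I : Type*} [Fintype I] (z : I → ℂ)
    (Q : I → Matrix (Fin m × Fin k) (Fin m × Fin k) ℂ) :
    pairTranspose (∑ i, z i • Q i) (∑ i, z i • Q i) =
      ∑ ij : I × I, (z ij.1 * z ij.2) • pairTranspose (Q ij.1) (Q ij.2) := by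
  ext x y
  simp only [pairTranspose, Matrix.submatrix_apply, Matrix.kroneckerMap_apply,
    Matrix.transpose_apply, Matrix.sum_apply, Matrix.smul_apply, smul_eq_mul,
    Fintype.sum_prod_type, Finset.sum_mul_sum]
  refine Finset.sum_congr rfl fun i _ => Finset.sum_congr rfl fun j _ => ?_
  ring

/-! ### The partial transpose of a state -/

lemma isHermitian_partialTranspose {ι κ : Type*} {ρ : Matrix (ι × κ) (ι × κ) ℂ}
    (hρ : ρ.IsHermitian) : (partialTranspose ρ).IsHermitian := by
  ext x y
  exact hρ.apply _ _

lemma trace_partialTranspose {ι κ : Type*} [Fintype ι] [Fintype κ]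
    (ρ : Matrix (ι × κ) (ι × κ) ℂ) : (partialTranspose ρ).trace = ρ.trace := rfl

/-- Partial transposition preserves the Hilbert–Schmidt norm. -/
lemma trace_partialTranspose_sq {ι κ : Type*} [Fintype ι] [Fintype κ]
    (ρ : Matrix (ι × κ) (ι × κ) ℂ) :
    (partialTranspose ρ * partialTranspose ρ).trace = (ρ * ρ).trace := by
  -- Both traces are the same fourfold sum with the two indices of the second factor exchanged.
  simp only [Matrix.trace, Matrix.diag_apply, Matrix.mul_apply, partialTranspose,
    Matrix.of_apply, Fintype.sum_prod_type]
  refine Finset.sum_congr rfl fun a _ => ?_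
  rw [Finset.sum_comm' (t' := Finset.univ) (s' := fun _ => Finset.univ) (by simp)]
  conv_rhs => rw [Finset.sum_comm]
  refine Finset.sum_congr rfl fun a' _ => ?_
  rw [Finset.sum_comm]

lemma IsState.trace_sq_le_one {ι : Type*} [Fintype ι] [DecidableEq ι] {σ : Matrix ι ι ℂ}
    (hσ : IsState σ) : (σ * σ).trace.re ≤ 1 := by
  obtain ⟨l, Q, -, -, -, hσQ, hl, hl0, hl1, -⟩ := hσ.exists_spectrum
  have hle : ∀ i, l i ≤ 1 := fun i =>
    hl1 ▸ Finset.single_le_sum (fun j _ => hl0 j) (Finset.mem_univ i)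
  have : (σ * σ).trace.re = ∑ i, l i * l i := by
    conv_lhs => rw [show σ * σ = (∑ i, (l i : ℂ) • Q i) * σ by rw [← hσQ]]
    rw [Finset.sum_mul, Matrix.trace_sum, Complex.re_sum]
    refine Finset.sum_congr rfl fun i _ => ?_
    rw [Matrix.smul_mul, Matrix.trace_smul, hl, smul_eq_mul, ← Complex.ofReal_mul,
      Complex.ofReal_re]
  rw [this, ← hl1]
  exact Finset.sum_le_sum fun i _ => mul_le_of_le_one_right (hl0 i) (hle i)

/-- Spectral data of the partial transpose of a state. -/
lemma exists_spectrum_partialTranspose {ι κ : Type*} [Fintype ι] [DecidableEq ι] [Fintype κ]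
    [DecidableEq κ] {ρ : Matrix (ι × κ) (ι × κ) ℂ} (hρ : IsState ρ) :
    ∃ (x : ι × κ → ℝ) (Q : ι × κ → Matrix (ι × κ) (ι × κ) ℂ), (∀ i, (Q i).PosSemidef) ∧
      (∀ i, (Q i).trace = 1) ∧ ∑ i, Q i = 1 ∧ partialTranspose ρ = ∑ i, (x i : ℂ) • Q i ∧
      ∑ i, x i = 1 ∧ (∀ i, |x i| ≤ 1) ∧
      traceNorm (partialTranspose ρ - maxMixed (ι × κ)) =
        ∑ i, |x i - (Fintype.card (ι × κ) : ℝ)⁻¹| := by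
  set δ : ℝ := (Fintype.card (ι × κ) : ℝ)⁻¹ with hδ
  have hmix : maxMixed (ι × κ) = (δ : ℂ) • 1 := by simp [maxMixed, hδ]
  have hH : (partialTranspose ρ - maxMixed (ι × κ)).IsHermitian := by
    refine (isHermitian_partialTranspose hρ.posSemidef.isHermitian).sub ?_
    rw [hmix]
    ext i j
    by_cases h : i = j
    · subst h; simp
    · simp [h, Ne.symm h]
  obtain ⟨l, Q, hQ, hQQ, hQ1, hsum, hf⟩ := exists_spectral_decomposition hH
  have hX : partialTranspose ρ = ∑ i, ((l i + δ : ℝ) : ℂ) • Q i := by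
    have h := hf fun x => x
    rw [cfc_id_eq hH, sub_eq_iff_eq_add, hmix, ← hsum, Finset.smul_sum,
      ← Finset.sum_add_distrib] at h
    rw [h]
    refine Finset.sum_congr rfl fun i _ => ?_
    rw [← add_smul, Complex.ofReal_add]
  refine ⟨fun i => l i + δ, Q, hQ, hQ1, hsum, hX, ?_, fun i => ?_, ?_⟩
  · have h := hρ.trace_eq_one
    rw [← trace_partialTranspose, hX, Matrix.trace_sum] at h
    simp only [Matrix.trace_smul, hQ1, smul_eq_mul, mul_one] at h
    exact_mod_cast h
  · have hQX : ∀ i, (Q i * partialTranspose ρ).trace = ((l i + δ : ℝ) : ℂ) := fun i => by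
      rw [hX, Finset.mul_sum, Matrix.trace_sum]
      simp [hQQ]
    -- The bound `|x i| ≤ 1` comes from purity: the squared eigenvalues of `ρ^Γ` sum to `Tr ρ² ≤ 1`.
    have h2 : (ρ * ρ).trace.re = ∑ i, (l i + δ) ^ 2 := by
      rw [← trace_partialTranspose_sq]
      conv_lhs =>
        rw [show partialTranspose ρ * partialTranspose ρ =
          (∑ i, ((l i + δ : ℝ) : ℂ) • Q i) * partialTranspose ρ by rw [← hX]]
      rw [Finset.sum_mul, Matrix.trace_sum, Complex.re_sum]
      refine Finset.sum_congr rfl fun i _ => ?_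
      rw [Matrix.smul_mul, Matrix.trace_smul, hQX, smul_eq_mul, ← Complex.ofReal_mul,
        Complex.ofReal_re, sq]
    have h3 : (l i + δ) ^ 2 ≤ ∑ i, (l i + δ) ^ 2 :=
      Finset.single_le_sum (f := fun i => (l i + δ) ^ 2) (fun j _ => sq_nonneg _)
        (Finset.mem_univ i)
    rw [← sq_le_one_iff_abs_le_one]
    exact h3.trans (h2 ▸ hρ.trace_sq_le_one)
  · simp only [add_sub_cancel_right]
    unfold traceNorm
    rw [hf, Matrix.trace_sum, Complex.re_sum]
    simp [hQ1]

lemma IsState.nonempty {ι : Type*} [Fintype ι] {σ : Matrix ι ι ℂ} (hσ : IsState σ) :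
    Nonempty ι := by
  by_contra h
  rw [not_nonempty_iff] at h
  have := hσ.trace_eq_one
  simp [Matrix.trace] at this

/-! ### The entropy of the output -/

lemma isState_traceC_map {m k : ℕ} {ρ : Matrix (Fin m × Fin k) (Fin m × Fin k) ℂ}
    (hρ : IsState ρ) {n : Labs} {Λ : (initialLabs m k).Op →ₗ[ℂ] n.Op}
    (hΛ : CLODCC (initialLabs m k) n Λ) : IsState (traceC (Λ (twoCopies ρ))) where
  posSemidef := posSemidef_traceC
    (hΛ.isUnitalPositive.posSemidef_map _ (isState_twoCopies hρ).posSemidef)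
  trace_eq_one := by
    rw [trace_traceC, hΛ.isUnitalPositive.trace_map, (isState_twoCopies hρ).trace_eq_one]

/-- The output on `AB` is the image of `ρ^Γ ⊗ (ρ^Γ)ᵀ` under a positive map. -/
lemma traceC_map_twoCopies {m k : ℕ} (ρ : Matrix (Fin m × Fin k) (Fin m × Fin k) ℂ)
    {n : Labs} (Λ : (initialLabs m k).Op →ₗ[ℂ] n.Op) :
    traceC (Λ (twoCopies ρ)) = traceC (conjTransposeC Λ
      (pairTranspose (partialTranspose ρ) (partialTranspose ρ))) := rfl

theorem log_card_sub_entropy_output_le {m k d : ℕ} (hd : d = m * k)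
    {ρ : Matrix (Fin m × Fin k) (Fin m × Fin k) ℂ} (hρ : IsState ρ) {ε : ℝ}
    (hε : ε = traceNorm (partialTranspose ρ - maxMixed (Fin m × Fin k)))
    (hεe : ε ≤ 1 / Real.exp 1) {n : Labs} {Λ : (initialLabs m k).Op →ₗ[ℂ] n.Op}
    (hΛ : CLODCC (initialLabs m k) n Λ) :
    Real.logb 2 (Fintype.card (Fin n.a × Fin n.b)) - entropy (traceC (Λ (twoCopies ρ))) ≤
      2 * ε * Real.logb 2 d + eta (2 * ε) := by
  have hcard : Fintype.card (Fin m × Fin k) = d := by simp [hd]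
  have hd0 : 0 < d := by
    rw [← hcard]
    exact Fintype.card_pos_iff.2 hρ.nonempty
  have hd0' : (0 : ℝ) < d := by exact_mod_cast hd0
  have hdim : Fintype.card ((Fin m × Fin k) × (Fin m × Fin k)) =
      Fintype.card (Fin n.a × Fin n.b) * n.c := by
    have := hΛ.dim_eq
    simp only [Fintype.card_prod, Fintype.card_fin]
    rw [this]
    ring
  have hc : 0 < n.c := by
    refine Nat.pos_of_ne_zero fun h => ?_
    rw [h, mul_zero, Fintype.card_prod, hcard] at hdim
    exact (Nat.mul_pos hd0 hd0).ne' hdim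
  obtain ⟨x, Q, hQ, hQ1, hQsum, hX, hx1, hxle, hnorm⟩ := exists_spectrum_partialTranspose hρ
  rw [← hε, hcard] at hnorm
  have hup := hΛ.conjTransposeC.isUnitalPositive
  have hone : ∑ ij : (Fin m × Fin k) × (Fin m × Fin k), pairTranspose (Q ij.1) (Q ij.2) = 1 := by
    have h := pairTranspose_sum (fun _ => 1) Q
    simp only [one_smul, one_mul, hQsum, pairTranspose_one] at h
    exact h.symm
  -- The positive unit-trace operators are the images of `Q i ⊗ (Q j)ᵀ`; by unitality they sum to
  -- `Tr_C 1 = |C| • 1`.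
  have hmain := (isState_traceC_map hρ hΛ).log_card_sub_entropy_le (c := n.c)
    (z := fun ij : (Fin m × Fin k) × (Fin m × Fin k) => x ij.1 * x ij.2)
    (R := fun ij => traceC (conjTransposeC Λ (pairTranspose (Q ij.1) (Q ij.2))))
    (fun ij => posSemidef_traceC (hup.posSemidef_map _ (posSemidef_pairTranspose (hQ _) (hQ _))))
    (fun ij => by rw [trace_traceC, hup.trace_map, trace_pairTranspose, hQ1, hQ1, one_mul])
    (by
      have h := traceC_sum_smul (fun _ : (Fin m × Fin k) × (Fin m × Fin k) => 1)
        fun ij => conjTransposeC Λ (pairTranspose (Q ij.1) (Q ij.2))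
      simp only [one_smul] at h
      rw [← h, ← map_sum, hone, hup.map_one, traceC_one])
    (by
      rw [traceC_map_twoCopies, hX, pairTranspose_sum, map_sum]
      simp only [map_smul, Complex.ofReal_mul]
      exact traceC_sum_smul _ _)
    hdim hc
  set u : Fin m × Fin k → ℝ := fun i => d * x i with hu
  have husum : ∑ i, u i = d := by rw [← Finset.mul_sum, hx1, mul_one]
  have hule : ∀ i, |u i| ≤ d := fun i => by
    rw [hu, abs_mul, abs_of_pos hd0']
    exact mul_le_of_le_one_right hd0'.le (hxle i)
  have hudist : ∑ i, |u i - 1| = 2 * (d * ε / 2) := by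
    rw [hnorm, mul_div_cancel₀ _ two_ne_zero, Finset.mul_sum]
    refine Finset.sum_congr rfl fun i _ => ?_
    rw [← abs_of_pos hd0', ← abs_mul, abs_of_pos hd0', mul_sub, mul_inv_cancel₀ hd0'.ne']
  have hsum := sum_mulPosLog_mul_le d u hcard husum hule hudist
  have hε0 : 0 ≤ ε := hnorm ▸ Finset.sum_nonneg fun i _ => abs_nonneg _
  have hJ : ∑ ij : (Fin m × Fin k) × (Fin m × Fin k),
      mulPosLog (Fintype.card ((Fin m × Fin k) × (Fin m × Fin k)) * (x ij.1 * x ij.2)) =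
      ∑ i, ∑ j, mulPosLog (u i * u j) := by
    rw [Fintype.sum_prod_type]
    refine Finset.sum_congr rfl fun i _ => Finset.sum_congr rfl fun j _ => ?_
    rw [Fintype.card_prod, hcard]
    push_cast
    congr 1
    simp only [hu]
    ring
  have hnat : (Real.logb 2 (Fintype.card (Fin n.a × Fin n.b)) -
      entropy (traceC (Λ (twoCopies ρ)))) * Real.log 2 ≤
      (ε + ε ^ 2) * Real.log d + (ε + ε ^ 2 / 2) * Real.log 2 := by
    refine hmain.trans ?_
    rw [hJ, Fintype.card_prod, hcard]
    refine (mul_le_mul_of_nonneg_left hsum (by positivity)).trans (le_of_eq ?_)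
    push_cast
    field_simp
    ring
  have hfinal : (ε + ε ^ 2) * Real.log d + (ε + ε ^ 2 / 2) * Real.log 2 ≤
      2 * ε * Real.log d + -(2 * ε) * Real.log (2 * ε) := by
    rcases Nat.lt_or_ge 1 d with h | h
    · exact numeric_entropy_bound h hε0 hεe
    -- The numerical bound needs `d ≥ 2`. For `d = 1`, `u ≤ 1` and mean one force `u = 1`, hence `ε
    -- = 0`.
    · have hd1 : d = 1 := le_antisymm h hd0
      have hz : ∑ i, |u i - 1| = 0 := by
        have : ∀ i, |u i - 1| = 1 - u i := fun i => by
          have h1 := (le_abs_self _).trans (hule i)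
          rw [hd1, Nat.cast_one] at h1
          rw [abs_of_nonpos (by linarith), neg_sub]
        simp_rw [this]
        rw [Finset.sum_sub_distrib, husum]
        simp [hd]
      have : ε = 0 := by
        rw [hudist, hd1, Nat.cast_one] at hz
        linarith
      simp [this]
  have h2 : 0 < Real.log 2 := Real.log_pos one_lt_two
  rw [← mul_le_mul_iff_left₀ h2]
  refine (hnat.trans hfinal).trans (le_of_eq ?_)
  simp only [eta, Real.logb]
  field_simp

end Repeater

theorem mainTheorem8 (m k d : ℕ) (hd : d = m * k)
    (ρ : Matrix (Fin m × Fin k) (Fin m × Fin k) ℂ) (hρ : Repeater.IsState ρ)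
    (ε : ℝ)
    (hε : ε = Repeater.traceNorm
      (Repeater.partialTranspose ρ - Repeater.maxMixed (Fin m × Fin k)))
    (hεe : ε ≤ 1 / Real.exp 1)
    (n : Repeater.Labs)
    (Λ : (Repeater.initialLabs m k).Op →ₗ[ℂ] n.Op)
    (hΛ : Repeater.CLODCC (Repeater.initialLabs m k) n Λ) :
    |Real.logb 2 ((n.a : ℝ) * (n.b : ℝ))
        - Repeater.entropy (Repeater.traceC (Λ (Repeater.twoCopies ρ)))|
      ≤ 2 * ε * Real.logb 2 (d : ℝ) + Repeater.eta (2 * ε) := by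
  have hcard : (Fintype.card (Fin n.a × Fin n.b) : ℝ) = n.a * n.b := by simp
  rw [← hcard, abs_of_nonneg
    (sub_nonneg.2 (Repeater.isState_traceC_map hρ hΛ).entropy_le_log_card)]
  exact Repeater.log_card_sub_entropy_output_le hd hρ hε hεe hΛ
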